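/- Let $(X,\|\cdot\|)$ be a (real or complex) Banach space and let $\tau$ be a locally convex Hausdorff topology on $X$ such that $(X,\|\cdot\|,\tau)$ is a bi-admissible space, i.e.: $\tau$ is coarser than the norm topology; every $\|\cdot\|$-bounded $\tau$-Cauchy sequence is $\tau$-convergent; and $\|x\|=\sup\{|\varphi(x)| : \varphi\in(X,\tau)',\ \|\varphi\|\le 1\}$ for all $x\in X$. A fundamental system of seminorms for $\tau$ is a set $\Gamma$ of $\tau$-continuous seminorms on $X$ such that every $\tau$-neighbourhood of $0$ contains $\{x\in X : p(x)<\varepsilon\}$ for some $p\in\Gamma$ and $\varepsilon>0$; it is norming if $\|x\|=\sup_{p\in\Gamma}p(x)$ for all $x\in X$. A family $(T(t))_{t\ge 0}$ of bounded linear operators on $X$ is a bi-continuous semigroup if 1. $T(0)=I$ and $T(t+s)=T(t)T(s)$ for all $s,t\ge0$; 2. $t\mapsto T(t)x$ is $\tau$-continuous on $[0,\infty)$ for every $x\in X$; 3. there are $M\ge1$ and $\omega\in\mathbb R$ with $\|T(t)\|\le Me^{\omega t}$ for all $t\ge0$; 4. for every norm-bounded sequence $(x_n)_{n\in\mathbb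 N}$ with $x_n\to0$ in $\tau$ and every $t_0\ge0$, $T(s)x_n\to0$ in $\tau$ uniformly for $s\in[0,t_0]$. It is a contraction semigroup if moreover $\|T(t)\|\le1$ for all $t\ge0$. Its generator is the operator whose domain consists of all $x\in X$ for which $\tau\text{-}\lim_{t\to0}\frac{T(t)x-x}{t}$ exists and $\sup_{t\in(0,1]}\frac{\|T(t)x-x\|}{t}<\infty$, and which maps such an $x$ to this limit. Let $A\colon D(A)\subseteq X\to X$ be a linear operator that is closed with respect to the norm and bi-densely defined, i.e. for every $x\in X$ there is a norm-bounded sequence in $D(A)$ that $\tau$-converges to $x$. The operator $A$ is called bi-dissipative if there is a norming fundamental system of seminorms $\Gamma$ for $\tau$ such that $p((\lambda-A)x)\ge\lambda p(x)$ for all $\lambda>0$, $p\in\Gamma$ and $x\in D(A)$. Then the following statements are equivalent. (a) $A$ is the generator of a bi-continuous contraction semigroup $(T(t))_{t\ge0}$, and there is a norming fundamental system of seminorms $\Gamma$ for $\tau$ such that $p(T(t)x)\le p(x)$ for all $t\ge0$, $p\in\Gamma$ and $x\in X$. (b) $A$ is bi-dissipative and $\lambda-A\colon D(A)\to X$ is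 surjective for some $\lambda>0$. -/

import Mathlib

open Filter Set
open scoped Topology NNReal

namespace BiContinuous

/-- A second topology `τ` on `X`. It is wrapped in a structure so that instance search
never mistakes it for the norm topology: every topological notion below refers to the norm
topology unless `τ.top` is written explicitly. -/
structure SecondTopology (X : Type*) where
  top : TopologicalSpace X

variable {𝕜 X : Type*} [RCLike 𝕜] [NormedAddCommGroup X] [NormedSpace 𝕜 X]

/-- `(X, ‖·‖, τ)` is a bi-admissible space. The norm topology is the one carried by the instances
on `X`; the coarser locally convex topology is the explicit argument `τ`. -/
structure IsBiAdmissible (𝕜 : Type*) {X : Type*} [RCLike 𝕜] [NormedAddCommGroup X]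
    [NormedSpace 𝕜 X] (τ : SecondTopology X) : Prop where
  /-- `X` is a Banach space. -/
  complete : CompleteSpace X
  /-- `τ` is a locally convex vector space topology, that is, it is induced by seminorms. -/
  locallyConvex : @PolynormableSpace 𝕜 X _ _ _ τ.top
  hausdorff : @T2Space X τ.top
  /-- The identity map from the norm topology to `τ` is continuous. -/
  coarser : Continuous[inferInstance, τ.top] (id : X → X)
  /-- Every norm-bounded `τ`-Cauchy sequence is `τ`-convergent. -/
  seqComplete : ∀ u : ℕ → X, (∃ C : ℝ, ∀ n, ‖u n‖ ≤ C) →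
    (∀ U ∈ @nhds X τ.top 0, ∃ N : ℕ, ∀ m ≥ N, ∀ n ≥ N, u m - u n ∈ U) →
    ∃ x : X, Tendsto u atTop (@nhds X τ.top x)
  /-- The dual of `(X, τ)` is norming. As `τ` is coarser than the norm topology, the `τ`-continuous
  functionals are the norm-continuous functionals that are moreover `τ`-continuous. -/
  norming : ∀ x : X,
    IsLUB {r : ℝ | ∃ φ : X →L[𝕜] 𝕜, Continuous[τ.top, inferInstance] φ ∧ ‖φ‖ ≤ 1 ∧ r = ‖φ x‖} ‖x‖

/-- `Γ` is a fundamental system of seminorms for `τ`: its members are `τ`-continuous and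
their balls around `0` form a neighbourhood basis of `0` for `τ`. -/
def IsFundamentalSystem (τ : SecondTopology X) (Γ : Set (Seminorm 𝕜 X)) : Prop :=
  (∀ p ∈ Γ, Continuous[τ.top, inferInstance] p) ∧
    ∀ U ∈ @nhds X τ.top 0, ∃ p ∈ Γ, ∃ ε : ℝ, 0 < ε ∧ {x : X | p x < ε} ⊆ U

/-- `‖x‖ = sup_{p ∈ Γ} p x` for all `x`. -/
def IsNorming (Γ : Set (Seminorm 𝕜 X)) : Prop :=
  ∀ x : X, IsLUB {r : ℝ | ∃ p ∈ Γ, r = p x} ‖x‖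

/-- The family of bounded operators `(T t)_{t ≥ 0}` is a bi-continuous semigroup. -/
structure IsBiContinuousSemigroup (τ : SecondTopology X) (T : ℝ≥0 → X →L[𝕜] X) : Prop where
  zero : T 0 = ContinuousLinearMap.id 𝕜 X
  add : ∀ t s : ℝ≥0, T (t + s) = (T t).comp (T s)
  stronglyContinuous : ∀ x : X, Continuous[inferInstance, τ.top] fun t : ℝ≥0 => T t x
  expBounded : ∃ M ω : ℝ, 1 ≤ M ∧ ∀ t : ℝ≥0, ‖T t‖ ≤ M * Real.exp (ω * t)
  locallyBiEquicontinuous : ∀ u : ℕ → X, (∃ C : ℝ, ∀ n, ‖u n‖ ≤ C) →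
    Tendsto u atTop (@nhds X τ.top 0) →
    ∀ t₀ : ℝ≥0, ∀ U ∈ @nhds X τ.top 0, ∀ᶠ n in atTop, ∀ s ≤ t₀, T s (u n) ∈ U

/-- `(T t)_{t ≥ 0}` is a contraction semigroup. -/
def IsContractive (T : ℝ≥0 → X →L[𝕜] X) : Prop :=
  ∀ t : ℝ≥0, ‖T t‖ ≤ 1

/-- The difference quotient `(T t x - x) / t`. -/
noncomputable def diffQuotient (T : ℝ≥0 → X →L[𝕜] X) (x : X) (t : ℝ≥0) : X :=
  (((t : ℝ) : 𝕜)⁻¹) • (T t x - x)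

/-- The operator `A` is the generator of `T`: its domain consists of all `x` for which the
difference quotients `τ`-converge as `t → 0` and are norm-bounded for `t ∈ (0, 1]`,
and on this domain `A x` is the `τ`-limit. -/
def IsGenerator (τ : SecondTopology X) (T : ℝ≥0 → X →L[𝕜] X) (A : X →ₗ.[𝕜] X) : Prop :=
  (∀ x : X, x ∈ A.domain ↔
    (∃ y : X, Tendsto (diffQuotient T x) (𝓝[>] 0) (@nhds X τ.top y)) ∧
      ∃ C : ℝ, ∀ t : ℝ≥0, 0 < t → t ≤ 1 → ‖T t x - x‖ / t ≤ C) ∧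
  ∀ x : A.domain, Tendsto (diffQuotient T (x : X)) (𝓝[>] 0) (@nhds X τ.top (A x))

/-- `A` is bi-densely defined: every point of `X` is the `τ`-limit of a norm-bounded sequence
in the domain of `A`. -/
def IsBiDenselyDefined (τ : SecondTopology X) (A : X →ₗ.[𝕜] X) : Prop :=
  ∀ x : X, ∃ u : ℕ → X, (∀ n, u n ∈ A.domain) ∧ (∃ C : ℝ, ∀ n, ‖u n‖ ≤ C) ∧
    Tendsto u atTop (@nhds X τ.top x)

/-- The operator `l - A` on the domain of `A`, for a real number `l`. -/
noncomputable def shift (A : X →ₗ.[𝕜] X) (l : ℝ) (x : A.domain) : X :=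
  (l : 𝕜) • (x : X) - A x

/-- `A` is bi-dissipative. -/
def IsBiDissipative (τ : SecondTopology X) (A : X →ₗ.[𝕜] X) : Prop :=
  ∃ Γ : Set (Seminorm 𝕜 X), IsFundamentalSystem τ Γ ∧
    (∀ l : ℝ, 0 < l → ∀ p ∈ Γ, ∀ x : A.domain, l * p (x : X) ≤ p (shift A l x)) ∧
    IsNorming Γ

end BiContinuous

/-! The argument replaces `τ` by a norming fundamental system `Γ`. Convergence in `τ` is convergence
for each `p ∈ Γ`, a bound common to all `p ∈ Γ` is a norm bound, and for `Γ`-contractions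
convergence on the bi-dense domain D(A) extends to all of `X`. No vector-valued integral occurs:
estimates usually read off from T(g)x − x = ∫₀^g T(s)Ax ds come from cutting [0, g] into equal
steps, telescoping with contractivity and refining (`sub_le`, `sub_sub_le`).

(b) ⇒ (a) is the Hille–Yosida construction. Neumann series carry surjectivity from l to l(3/2)^n.
The Yosida approximations at these points commute, generate `Γ`-contractive exponential semigroups,
and tend to A on D(A), so `sub_le` makes the semigroups Cauchy. By `tendsto_diffQuotient_of_tendsto`
the generator of the limit extends A; since l − A is onto and l minus the generator is injective,
the two coincide.

(a) ⇒ (b): dissipativity passes from difference quotients to their limit. For the range of 1 − A,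
the Laplace transform is replaced by a limit K of resolvents of difference quotients. K commutes
with T and satisfies K(1 − A) = 1 on D(A). Approximating x from D(A) and using again that graphs of
generators are stable under limits gives Kx ∈ D(A) and (1 − A)Kx = x. -/

namespace BiContinuous

variable {𝕜 X : Type*} [RCLike 𝕜] [NormedAddCommGroup X] [NormedSpace 𝕜 X]

/-- Convergence with respect to a family of seminorms. -/
def SeminormTendsto {ι : Type*} (Γ : Set (Seminorm 𝕜 X)) (u : ι → X) (l : Filter ι) (x : X) :
    Prop :=
  ∀ p ∈ Γ, Tendsto (fun i => p (u i - x)) l (𝓝 0)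

/-- `S` satisfies the semigroup law and every `S t` is contractive for all seminorms in `Γ`. -/
structure IsSeminormContractionSemigroup (Γ : Set (Seminorm 𝕜 X)) (S : ℝ≥0 → X →L[𝕜] X) :
    Prop where
  zero : S 0 = ContinuousLinearMap.id 𝕜 X
  add : ∀ t s : ℝ≥0, S (t + s) = (S t).comp (S s)
  contract : ∀ p ∈ Γ, ∀ t x, p (S t x) ≤ p x

/-! ### Calculus of convergence along a norming family of seminorms -/

section Seminorms

variable {Γ : Set (Seminorm 𝕜 X)} {ι : Type*} {l : Filter ι} {u v : ι → X} {x y : X}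

theorem seminorm_sub_le (p : Seminorm 𝕜 X) (x y z : X) : p (x - z) ≤ p (x - y) + p (y - z) := by
  simpa using map_add_le_add p (x - y) (y - z)

theorem seminorm_ofReal_smul (p : Seminorm 𝕜 X) {r : ℝ} (hr : 0 ≤ r) (x : X) :
    p ((r : 𝕜) • x) = r * p x := by
  rw [map_smul_eq_mul, RCLike.norm_of_nonneg hr]

theorem IsNorming.le_norm (hΓ : IsNorming Γ) {p : Seminorm 𝕜 X} (hp : p ∈ Γ) (x : X) :
    p x ≤ ‖x‖ :=
  (hΓ x).1 ⟨p, hp, rfl⟩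

theorem IsNorming.norm_le (hΓ : IsNorming Γ) {c : ℝ} (h : ∀ p ∈ Γ, p x ≤ c) : ‖x‖ ≤ c :=
  (hΓ x).2 (by rintro _ ⟨p, hp, rfl⟩; exact h p hp)

theorem IsNorming.eq_of_forall (hΓ : IsNorming Γ) (h : ∀ p ∈ Γ, p (x - y) ≤ 0) : x = y :=
  sub_eq_zero.1 (norm_le_zero_iff.1 (hΓ.norm_le h))

theorem IsNorming.continuous (hΓ : IsNorming Γ) {p : Seminorm 𝕜 X} (hp : p ∈ Γ) :
    Continuous p :=
  Seminorm.continuous_of_le (q := normSeminorm 𝕜 X) continuous_norm fun x => hΓ.le_norm hp x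

theorem SeminormTendsto.of_tendsto (hΓ : IsNorming Γ) (h : Tendsto u l (𝓝 x)) :
    SeminormTendsto Γ u l x := fun p hp => by
  have := ((hΓ.continuous hp).tendsto 0).comp (tendsto_sub_nhds_zero_iff.2 h)
  simpa [Function.comp_def] using this

theorem SeminormTendsto.sub (hu : SeminormTendsto Γ u l x) (hv : SeminormTendsto Γ v l y) :
    SeminormTendsto Γ (fun i => u i - v i) l (x - y) := fun p hp => by
  refine squeeze_zero (fun i => apply_nonneg p _) (fun i => ?_)
    (by simpa using (hu p hp).add (hv p hp))
  rw [sub_sub_sub_comm]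
  exact map_sub_le_add p _ _

theorem SeminormTendsto.add (hu : SeminormTendsto Γ u l x) (hv : SeminormTendsto Γ v l y) :
    SeminormTendsto Γ (fun i => u i + v i) l (x + y) := fun p hp => by
  refine squeeze_zero (fun i => apply_nonneg p _) (fun i => ?_)
    (by simpa using (hu p hp).add (hv p hp))
  rw [add_sub_add_comm]
  exact map_add_le_add p _ _

theorem SeminormTendsto.smul (c : 𝕜) (hu : SeminormTendsto Γ u l x) :
    SeminormTendsto Γ (fun i => c • u i) l (c • x) := fun p hp => by
  simpa [← smul_sub, map_smul_eq_mul] using (hu p hp).const_mul ‖c‖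

theorem SeminormTendsto.const (x : X) : SeminormTendsto Γ (fun _ : ι => x) l x :=
  fun p _ => by simpa using tendsto_const_nhds

theorem SeminormTendsto.of_le (hu : SeminormTendsto Γ u l x)
    (h : ∀ p ∈ Γ, ∀ i, p (v i - y) ≤ p (u i - x)) : SeminormTendsto Γ v l y :=
  fun p hp => squeeze_zero (fun _ => apply_nonneg p _) (h p hp) (hu p hp)

theorem SeminormTendsto.tendsto (hu : SeminormTendsto Γ u l x) {p : Seminorm 𝕜 X} (hp : p ∈ Γ) :
    Tendsto (fun i => p (u i)) l (𝓝 (p x)) := by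
  rw [← tendsto_sub_nhds_zero_iff]
  exact squeeze_zero_norm (fun i => by simpa using abs_sub_map_le_sub p (u i) x) (hu p hp)

theorem SeminormTendsto.eventually_sub_le {u : ℕ → X} (hu : SeminormTendsto Γ u atTop x)
    {p : Seminorm 𝕜 X} (hp : p ∈ Γ) {ε : ℝ} (hε : 0 < ε) :
    ∀ᶠ n in atTop, ∀ m ≥ n, p (u m - u n) ≤ ε := by
  have h1 := (hu p hp).eventually_le_const (half_pos hε)
  filter_upwards [eventually_forall_ge_atTop.2 h1] with n hn m hm
  have h2 := hn n le_rfl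
  rw [map_sub_rev] at h2
  linarith [seminorm_sub_le p (u m) x (u n), hn m hm]

theorem SeminormTendsto.unique [l.NeBot] (hΓ : IsNorming Γ) (hx : SeminormTendsto Γ u l x)
    (hy : SeminormTendsto Γ u l y) : x = y := by
  refine hΓ.eq_of_forall fun p hp => ?_
  have lim : Tendsto (fun i => p (u i - x) + p (u i - y)) l (𝓝 0) := by
    simpa using (hx p hp).add (hy p hp)
  refine ge_of_tendsto' lim fun i => ?_
  rw [map_sub_rev p (u i) x]
  exact seminorm_sub_le p _ _ _

end Seminorms

/-! ### Passage between `τ` and `Γ`, and extension from the bi-dense domain -/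

section Topology

variable {τ : SecondTopology X} {Γ : Set (Seminorm 𝕜 X)}

/-- A polynormable topology is a group topology, so convergence can be tested at 0, where the balls
of `Γ` form a neighbourhood basis. -/
theorem tendsto_iff_seminormTendsto (hτ : IsBiAdmissible 𝕜 τ) (hΓ : IsFundamentalSystem τ Γ)
    {ι : Type*} {l : Filter ι} {u : ι → X} {x : X} :
    Tendsto u l (@nhds X τ.top x) ↔ SeminormTendsto Γ u l x := by
  obtain ⟨hc, hb⟩ := hΓ
  have hG : @IsTopologicalAddGroup X τ.top _ := by
    let := τ.top
    have := hτ.locallyConvex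
    exact (PolynormableSpace.withSeminorms 𝕜 X).topologicalAddGroup
  have key : Tendsto u l (@nhds X τ.top x) ↔ Tendsto (fun i => u i - x) l (@nhds X τ.top 0) :=
    (@tendsto_sub_nhds_zero_iff X _ τ.top hG ι l x u).symm
  rw [key]
  constructor
  · intro h p hp
    have h0 : Tendsto p (@nhds X τ.top 0) (𝓝 (p 0)) := @Continuous.tendsto _ _ τ.top _ _ (hc p hp) 0
    rw [map_zero] at h0
    exact h0.comp h
  · intro h U hU
    obtain ⟨p, hp, ε, hε, hsub⟩ := hb U hU
    exact ((h p hp).eventually_lt_const hε).mono fun i hi => hsub hi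

theorem exists_seminormTendsto (hτ : IsBiAdmissible 𝕜 τ) (hΓ : IsFundamentalSystem τ Γ)
    {u : ℕ → X} {C : ℝ} (hC : ∀ n, ‖u n‖ ≤ C)
    (hu : ∀ p ∈ Γ, ∀ ε > 0, ∀ᶠ n in atTop, ∀ m ≥ n, p (u m - u n) ≤ ε) :
    ∃ x, SeminormTendsto Γ u atTop x := by
  obtain ⟨x, hx⟩ := hτ.seqComplete u ⟨C, hC⟩ fun U hU => by
    obtain ⟨p, hp, ε, hε, hsub⟩ := hΓ.2 U hU
    -- Both terms are compared with index N; 2ε/3 leaves room for the strict inequality.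
    obtain ⟨N, hN⟩ := (hu p hp (ε / 3) (by positivity)).exists
    refine ⟨N, fun m hm n hn => hsub ?_⟩
    have h1 := hN m hm
    have h2 := hN n hn
    rw [map_sub_rev] at h2
    have := seminorm_sub_le p (u m) (u N) (u n)
    change p (u m - u n) < ε
    linarith
  exact ⟨x, (tendsto_iff_seminormTendsto hτ hΓ).1 hx⟩

theorem IsBiDenselyDefined.exists_seq {A : X →ₗ.[𝕜] X} (hdense : IsBiDenselyDefined τ A)
    (hτ : IsBiAdmissible 𝕜 τ) (hΓ : IsFundamentalSystem τ Γ) (x : X) :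
    ∃ u : ℕ → A.domain, SeminormTendsto Γ (fun n => (u n : X)) atTop x := by
  obtain ⟨u, hu, -, h⟩ := hdense x
  exact ⟨fun n => ⟨u n, hu n⟩, (tendsto_iff_seminormTendsto hτ hΓ).1 h⟩

theorem IsBiDenselyDefined.exists_near {A : X →ₗ.[𝕜] X} (hdense : IsBiDenselyDefined τ A)
    (hτ : IsBiAdmissible 𝕜 τ) (hΓ : IsFundamentalSystem τ Γ) (x : X) {p : Seminorm 𝕜 X}
    (hp : p ∈ Γ) {ε : ℝ} (hε : 0 < ε) : ∃ v : A.domain, p ((v : X) - x) < ε := by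
  obtain ⟨u, h⟩ := hdense.exists_seq hτ hΓ x
  obtain ⟨n, hn⟩ := ((h p hp).eventually_lt_const hε).exists
  exact ⟨u n, hn⟩

/-- If a sequence of `Γ`-contractions converges to the identity on a bi-dense domain, it does so
everywhere. -/
theorem seminormTendsto_self_of_biDense (hτ : IsBiAdmissible 𝕜 τ)
    (hΓ : IsFundamentalSystem τ Γ) {A : X →ₗ.[𝕜] X}
    (hdense : IsBiDenselyDefined τ A) {S : ℕ → X →L[𝕜] X}
    (hS : ∀ p ∈ Γ, ∀ n x, p (S n x) ≤ p x)
    (h : ∀ x : A.domain, SeminormTendsto Γ (fun n => S n (x : X)) atTop x) (x : X) :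
    SeminormTendsto Γ (fun n => S n x) atTop x := by
  intro p hp
  rw [Metric.tendsto_nhds]
  intro ε hε
  obtain ⟨v, hv⟩ := hdense.exists_near hτ hΓ x hp (ε := ε / 3) (by positivity)
  filter_upwards [(h v p hp).eventually_lt_const (show 0 < ε / 3 by positivity)] with n hn
  rw [Real.dist_0_eq_abs, abs_of_nonneg (apply_nonneg p _)]
  have h1 := hS p hp n (x - v)
  rw [map_sub, map_sub_rev p x] at h1
  linarith [seminorm_sub_le p (S n x) (S n v) x, seminorm_sub_le p (S n v) v x]

/-- A bounded sequence of `Γ`-contractions that is `Γ`-Cauchy on a bi-dense domain converges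
everywhere. -/
theorem exists_seminormTendsto_of_biDense (hτ : IsBiAdmissible 𝕜 τ)
    (hΓ : IsFundamentalSystem τ Γ) (hN : IsNorming Γ) {A : X →ₗ.[𝕜] X}
    (hdense : IsBiDenselyDefined τ A) {S : ℕ → X →L[𝕜] X}
    (hS : ∀ p ∈ Γ, ∀ n x, p (S n x) ≤ p x)
    (hC : ∀ x : A.domain, ∀ p ∈ Γ, ∀ ε > 0, ∀ᶠ n in atTop, ∀ m ≥ n,
      p (S m (x : X) - S n (x : X)) ≤ ε) (x : X) :
    ∃ y, SeminormTendsto Γ (fun n => S n x) atTop y := by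
  refine exists_seminormTendsto hτ hΓ (C := ‖x‖)
    (fun n => hN.norm_le fun p hp => (hS p hp n x).trans (hN.le_norm hp x)) fun p hp ε hε => ?_
  obtain ⟨v, hv⟩ := hdense.exists_near hτ hΓ x hp (ε := ε / 3) (by positivity)
  filter_upwards [hC v p hp (ε / 3) (by positivity)] with n hn m hm
  have h1 := hn m hm
  have h2 := hS p hp m (x - v)
  have h3 := hS p hp n (v - x)
  rw [map_sub] at h2 h3
  rw [map_sub_rev p x] at h2
  have h4 := seminorm_sub_le p (S m x) (S m v) (S n x)
  have h5 := seminorm_sub_le p (S m v) (S n v) (S n x)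
  linarith

end Topology

/-! ### Telescoping estimates for contraction semigroups -/

section Semigroup

variable {Γ : Set (Seminorm 𝕜 X)} {S S' T : ℝ≥0 → X →L[𝕜] X}

theorem smul_diffQuotient (S : ℝ≥0 → X →L[𝕜] X) (x : X) {h : ℝ≥0} (hh : h ≠ 0) :
    ((h : ℝ) : 𝕜) • diffQuotient S x h = S h x - x := by
  rw [diffQuotient, smul_smul, mul_inv_cancel₀, one_smul]
  simpa using hh

theorem tendsto_div_nat_nhdsGT {g : ℝ≥0} (hg : 0 < g) :
    Tendsto (fun n : ℕ => g / (n + 1)) atTop (𝓝[>] 0) := by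
  rw [tendsto_nhdsWithin_iff]
  refine ⟨?_, Eventually.of_forall fun n => by simp only [mem_Ioi]; positivity⟩
  rw [← NNReal.tendsto_coe]
  simpa [div_eq_mul_inv] using (tendsto_one_div_add_atTop_nhds_zero_nat (𝕜 := ℝ)).const_mul (g : ℝ)

/-- Telescoping: each further step adds one copy of `S h x - S' h x`, moved by a contraction;
commutation puts S in front of it. -/
theorem IsSeminormContractionSemigroup.iterate_sub_le
    (hS : IsSeminormContractionSemigroup Γ S) (hS' : IsSeminormContractionSemigroup Γ S')
    (hcomm : ∀ t s x, S t (S' s x) = S' s (S t x)) {p : Seminorm 𝕜 X} (hp : p ∈ Γ) (h : ℝ≥0)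
    (x : X) (n : ℕ) : p (S (n * h) x - S' (n * h) x) ≤ n * p (S h x - S' h x) := by
  induction n with
  | zero => simp [hS.zero, hS'.zero]
  | succ n ih =>
    have e : S ((n + 1 : ℕ) * h) x - S' ((n + 1 : ℕ) * h) x
        = S (n * h) (S h x - S' h x) + S' h (S (n * h) x - S' (n * h) x) := by
      have h1 : ((n + 1 : ℕ) : ℝ≥0) * h = n * h + h := by push_cast; ring
      have h2 : S' (n * h + h) x = S' h (S' (n * h) x) := by rw [add_comm, hS'.add]; rfl
      rw [h1, h2, hS.add, map_sub, map_sub, hcomm]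
      simp
    rw [e]
    have h1 := hS.contract p hp (n * h) (S h x - S' h x)
    have h2 := hS'.contract p hp h (S (n * h) x - S' (n * h) x)
    have h3 := map_add_le_add p (S (n * h) (S h x - S' h x)) (S' h (S (n * h) x - S' (n * h) x))
    push_cast
    linarith

/-- Commuting contraction semigroups differ by at most the difference of their generators. -/
theorem IsSeminormContractionSemigroup.sub_le
    (hS : IsSeminormContractionSemigroup Γ S) (hS' : IsSeminormContractionSemigroup Γ S')
    (hcomm : ∀ t s x, S t (S' s x) = S' s (S t x)) {x y y' : X}
    (hy : SeminormTendsto Γ (diffQuotient S x) (𝓝[>] 0) y)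
    (hy' : SeminormTendsto Γ (diffQuotient S' x) (𝓝[>] 0) y')
    {p : Seminorm 𝕜 X} (hp : p ∈ Γ) (g : ℝ≥0) :
    p (S g x - S' g x) ≤ g * p (y - y') := by
  rcases eq_or_ne g 0 with rfl | hg
  · simp [hS.zero, hS'.zero]
  have hg' : 0 < g := pos_iff_ne_zero.2 hg
  -- The step g/(n+1) divides g exactly, so the discrete estimate applies at time g for every n.
  have lim := (((hy.sub hy').tendsto hp).comp (tendsto_div_nat_nhdsGT hg')).const_mul (g : ℝ)
  refine ge_of_tendsto' lim fun n => ?_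
  set h := g / (n + 1) with hh
  have hpos : 0 < h := by positivity
  have e : g = (n + 1 : ℕ) * h := by rw [hh]; push_cast; field_simp
  have h1 := hS.iterate_sub_le hS' hcomm hp h x (n + 1)
  rw [← e] at h1
  refine h1.trans (le_of_eq ?_)
  have h2 : S h x - S' h x = ((h : ℝ) : 𝕜) • (diffQuotient S x h - diffQuotient S' x h) := by
    rw [smul_sub, smul_diffQuotient S x hpos.ne', smul_diffQuotient S' x hpos.ne']; abel
  rw [h2, seminorm_ofReal_smul p h.coe_nonneg, ← mul_assoc]
  congr 1
  conv_rhs => rw [e]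
  push_cast; ring

theorem isSeminormContractionSemigroup_id :
    IsSeminormContractionSemigroup Γ fun _ => ContinuousLinearMap.id 𝕜 X :=
  ⟨rfl, fun _ _ => rfl, fun _ _ _ _ => le_rfl⟩

/-- Comparison with the identity semigroup, whose generator is 0. -/
theorem IsSeminormContractionSemigroup.sub_self_le
    (hS : IsSeminormContractionSemigroup Γ S) {x y : X}
    (hy : SeminormTendsto Γ (diffQuotient S x) (𝓝[>] 0) y)
    {p : Seminorm 𝕜 X} (hp : p ∈ Γ) (g : ℝ≥0) : p (S g x - x) ≤ g * p y := by
  have h0 : SeminormTendsto Γ (diffQuotient (fun _ => ContinuousLinearMap.id 𝕜 X) x)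
      (𝓝[>] (0 : ℝ≥0)) 0 := by
    intro p hp
    simp [diffQuotient]
  simpa using hS.sub_le isSeminormContractionSemigroup_id (fun _ _ _ => rfl) hy h0 hp g

/-- Riemann-sum form of S(g)x − x − gy = ∫₀^g (S(s)y − y) ds: every step of length h contributes a
quotient error at x and an oscillation of the orbit of y. -/
theorem IsSeminormContractionSemigroup.iterate_sub_sub_le
    (hS : IsSeminormContractionSemigroup Γ S) {p : Seminorm 𝕜 X} (hp : p ∈ Γ) {h : ℝ≥0}
    (hh : h ≠ 0) (x y : X) {c : ℝ} (n : ℕ) (hc : ∀ s ≤ n * h, p (S s y - y) ≤ c) :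
    p (S (n * h) x - x - (((n * h : ℝ≥0) : ℝ) : 𝕜) • y)
      ≤ (n * h) * (p (diffQuotient S x h - y) + c) := by
  induction n with
  | zero => simp [hS.zero]
  | succ n ih =>
    have hle : (n : ℝ≥0) * h ≤ (n + 1 : ℕ) * h := by gcongr; simp
    have e : S ((n + 1 : ℕ) * h) x - x - ((((n + 1 : ℕ) * h : ℝ≥0) : ℝ) : 𝕜) • y
        = S (n * h) (((h : ℝ) : 𝕜) • (diffQuotient S x h - y))
          + (S (n * h) x - x - (((n * h : ℝ≥0) : ℝ) : 𝕜) • y)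
          + ((h : ℝ) : 𝕜) • (S (n * h) y - y) := by
      have h1 : ((n + 1 : ℕ) : ℝ≥0) * h = n * h + h := by push_cast; ring
      rw [h1, hS.add, smul_sub ((h : ℝ) : 𝕜) (diffQuotient S x h), smul_diffQuotient S x hh]
      simp only [map_sub, map_smul, NNReal.coe_add, ContinuousLinearMap.comp_apply,
        map_add, add_smul, smul_sub]
      abel
    rw [e]
    have h1 := hS.contract p hp (n * h) (((h : ℝ) : 𝕜) • (diffQuotient S x h - y))
    have h2 := ih fun s hs => hc s (hs.trans hle)
    have h3 := map_add_le_add p (S (n * h) (((h : ℝ) : 𝕜) • (diffQuotient S x h - y))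
      + (S (n * h) x - x - (((n * h : ℝ≥0) : ℝ) : 𝕜) • y)) (((h : ℝ) : 𝕜) • (S (n * h) y - y))
    have h4 := map_add_le_add p (S (n * h) (((h : ℝ) : 𝕜) • (diffQuotient S x h - y)))
      (S (n * h) x - x - (((n * h : ℝ≥0) : ℝ) : 𝕜) • y)
    rw [seminorm_ofReal_smul p h.coe_nonneg] at h1 h3
    have h5 := mul_le_mul_of_nonneg_left (hc _ hle) h.coe_nonneg
    push_cast at *
    linarith

theorem IsSeminormContractionSemigroup.sub_sub_le
    (hS : IsSeminormContractionSemigroup Γ S) {x y : X}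
    (hy : SeminormTendsto Γ (diffQuotient S x) (𝓝[>] 0) y)
    {p : Seminorm 𝕜 X} (hp : p ∈ Γ) {g : ℝ≥0} {c : ℝ} (hc : ∀ s ≤ g, p (S s y - y) ≤ c) :
    p (S g x - x - ((g : ℝ) : 𝕜) • y) ≤ g * c := by
  rcases eq_or_ne g 0 with rfl | hg
  · simp [hS.zero]
  have hg' : 0 < g := pos_iff_ne_zero.2 hg
  have lim := (((hy p hp).comp (tendsto_div_nat_nhdsGT hg')).add_const c).const_mul (g : ℝ)
  rw [zero_add] at lim
  refine ge_of_tendsto' lim fun n => ?_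
  set h := g / (n + 1) with hh
  have hpos : 0 < h := by positivity
  have e : g = (n + 1 : ℕ) * h := by rw [hh]; push_cast; field_simp
  have h1 := hS.iterate_sub_sub_le hp hpos.ne' x y (c := c) (n + 1) (by rwa [← e])
  rw [← e] at h1
  refine h1.trans (le_of_eq ?_)
  simp only [Function.comp_apply]
  rw [← hh]
  conv_rhs => rw [e]
  push_cast
  rfl

/-- If contraction semigroups `S i` converge to `T` along converging elements of the graphs of their
generators, then the limit belongs to the graph of the generator of `T`. -/
theorem tendsto_diffQuotient_of_tendsto {ι : Type*} {l : Filter ι} [l.NeBot]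
    {S : ι → ℝ≥0 → X →L[𝕜] X} (hS : ∀ i, IsSeminormContractionSemigroup Γ (S i))
    {x y : X} {u v : ι → X}
    (huv : ∀ i, SeminormTendsto Γ (diffQuotient (S i) (u i)) (𝓝[>] 0) (v i))
    (hu : SeminormTendsto Γ u l x) (hv : SeminormTendsto Γ v l y)
    (hT : ∀ t, SeminormTendsto Γ (fun i => S i t (u i)) l (T t x))
    (hcont : ∀ p ∈ Γ, ∀ ε : ℝ, 0 < ε → ∃ δ : ℝ≥0, 0 < δ ∧ ∀ i, ∀ s ≤ δ, p (S i s y - y) ≤ ε) :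
    SeminormTendsto Γ (diffQuotient T x) (𝓝[>] 0) y ∧
      ∀ p ∈ Γ, ∀ g, p (T g x - x) ≤ g * p y := by
  constructor
  · intro p hp
    rw [Metric.tendsto_nhds]
    intro ε hε
    obtain ⟨δ, hδ, hc⟩ := hcont p hp (ε / 4) (by positivity)
    filter_upwards [Ioc_mem_nhdsGT hδ] with g hg
    have hg0 : (0 : ℝ) < g := hg.1
    -- Of the three quarters of ε, two pay for replacing `v i` by y and one for the oscillation of
    -- the orbit of y; this bound is uniform in i.
    have key : p (T g x - x - ((g : ℝ) : 𝕜) • y) ≤ g * (3 * (ε / 4)) := by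
      refine le_of_tendsto ((((hT g).sub hu).sub (hv.smul ((g : ℝ) : 𝕜))).tendsto hp) ?_
      filter_upwards [(hv p hp).eventually_le_const (show (0 : ℝ) < ε / 4 by positivity)] with i hi
      refine (hS i).sub_sub_le (huv i) hp fun s hs => ?_
      have h1 := (hS i).contract p hp s (v i - y)
      have h2 := hc i s (hs.trans hg.2)
      have h3 := seminorm_sub_le p (S i s (v i)) (S i s y) (v i)
      have h4 := seminorm_sub_le p (S i s y) y (v i)
      rw [map_sub] at h1
      rw [map_sub_rev p y (v i)] at h4
      linarith
    have e : T g x - x - ((g : ℝ) : 𝕜) • y = ((g : ℝ) : 𝕜) • (diffQuotient T x g - y) := by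
      rw [smul_sub, smul_diffQuotient T x hg.1.ne']
    rw [e, seminorm_ofReal_smul p g.coe_nonneg] at key
    have := le_of_mul_le_mul_left key hg0
    rw [Real.dist_0_eq_abs, abs_of_nonneg (apply_nonneg p _)]
    linarith
  · intro p hp g
    exact le_of_tendsto_of_tendsto' (((hT g).sub hu).tendsto hp) ((hv.tendsto hp).const_mul _)
      fun i => (hS i).sub_self_le (huv i) hp g

end Semigroup

variable {Γ : Set (Seminorm 𝕜 X)} {τ : SecondTopology X}

/-! ### Pointwise limits of contractions -/

section Limits

variable {S : ℕ → X →L[𝕜] X}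

/-- A pointwise limit of `Γ`-contractions is a bounded operator and a `Γ`-contraction. -/
theorem exists_limit_operator (hN : IsNorming Γ) (hS : ∀ p ∈ Γ, ∀ n x, p (S n x) ≤ p x)
    (h : ∀ x, ∃ y, SeminormTendsto Γ (fun n => S n x) atTop y) :
    ∃ K : X →L[𝕜] X, (∀ x, SeminormTendsto Γ (fun n => S n x) atTop (K x)) ∧
      ∀ p ∈ Γ, ∀ x, p (K x) ≤ p x := by
  choose K hK using h
  have hKp : ∀ p ∈ Γ, ∀ x, p (K x) ≤ p x := fun p hp x =>
    le_of_tendsto' ((hK x).tendsto hp) fun n => hS p hp n x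
  refine ⟨LinearMap.mkContinuous ⟨⟨K, fun x y => ?_⟩, fun c x => ?_⟩ 1 fun x => ?_, hK, hKp⟩
  · refine SeminormTendsto.unique hN (hK (x + y)) ?_
    simpa using (hK x).add (hK y)
  · refine SeminormTendsto.unique hN (hK (c • x)) ?_
    simpa using (hK x).smul c
  · exact hN.norm_le fun p hp => (hKp p hp x).trans (by simpa using hN.le_norm hp x)

theorem SeminormTendsto.apply_of_contract (hS : ∀ p ∈ Γ, ∀ n x, p (S n x) ≤ p x) {x y : X}
    {u : ℕ → X} (hK : SeminormTendsto Γ (fun n => S n x) atTop y)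
    (hu : SeminormTendsto Γ u atTop x) : SeminormTendsto Γ (fun n => S n (u n)) atTop y := by
  have h : SeminormTendsto Γ (fun n => S n (u n - x)) atTop 0 := by
    refine hu.of_le fun p hp n => ?_
    simpa using hS p hp n (u n - x)
  simpa using h.add hK

theorem SeminormTendsto.apply {K : X →L[𝕜] X} (hK : ∀ p ∈ Γ, ∀ x, p (K x) ≤ p x)
    {ι : Type*} {l : Filter ι} {u : ι → X} {x : X} (hu : SeminormTendsto Γ u l x) :
    SeminormTendsto Γ (fun i => K (u i)) l (K x) :=
  hu.of_le fun p hp i => by simpa using hK p hp (u i - x)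

end Limits

/-! ### Dissipativity and resolvents of difference quotients -/

section Dissipative

variable {S : ℝ≥0 → X →L[𝕜] X}

/-- After multiplication by h the right-hand vector is (1 + hl)x − S(h)x, and p(S(h)x) ≤ p(x). -/
theorem mul_le_sub_diffQuotient (hS : IsSeminormContractionSemigroup Γ S) {p : Seminorm 𝕜 X}
    (hp : p ∈ Γ) {l : ℝ} (hl : 0 ≤ l) {h : ℝ≥0} (hh : 0 < h) (x : X) :
    l * p x ≤ p ((l : 𝕜) • x - diffQuotient S x h) := by
  have hh' : (0 : ℝ) < h := hh
  have e : ((h : ℝ) : 𝕜) • ((l : 𝕜) • x - diffQuotient S x h)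
      = ((1 + h * l : ℝ) : 𝕜) • x - S h x := by
    rw [smul_sub, smul_diffQuotient S x hh.ne']
    push_cast
    rw [add_smul, one_smul, mul_smul]
    abel
  have h1 := seminorm_ofReal_smul p h.coe_nonneg ((l : 𝕜) • x - diffQuotient S x h)
  have h2 := seminorm_ofReal_smul p (show 0 ≤ 1 + h * l by positivity) x
  have h3 := map_sub_le_add p (((1 + h * l : ℝ) : 𝕜) • x - S h x) (-S h x)
  have h4 := hS.contract p hp h x
  rw [sub_neg_eq_add, sub_add_cancel, map_neg_eq_map] at h3
  rw [e] at h1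
  refine le_of_mul_le_mul_left ?_ hh'
  rw [← h1]
  linarith

theorem mul_le_sub_of_tendsto (hS : IsSeminormContractionSemigroup Γ S) {p : Seminorm 𝕜 X}
    (hp : p ∈ Γ) {l : ℝ} (hl : 0 ≤ l) {x y : X}
    (hy : SeminormTendsto Γ (diffQuotient S x) (𝓝[>] 0) y) :
    l * p x ≤ p ((l : 𝕜) • x - y) := by
  refine ge_of_tendsto (((SeminormTendsto.const ((l : 𝕜) • x)).sub hy).tendsto hp) ?_
  filter_upwards [self_mem_nhdsWithin] with h hh
  exact mul_le_sub_diffQuotient hS hp hl hh x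

theorem diffQuotient_sub (S : ℝ≥0 → X →L[𝕜] X) (h : ℝ≥0) (x y : X) :
    diffQuotient S (x - y) h = diffQuotient S x h - diffQuotient S y h := by
  simp only [diffQuotient, map_sub, ← smul_sub]
  congr 1
  abel

theorem map_diffQuotient {K : X →L[𝕜] X} {h : ℝ≥0} (hK : ∀ x, K (S h x) = S h (K x)) (x : X) :
    K (diffQuotient S x h) = diffQuotient S (K x) h := by
  simp [diffQuotient, hK]

theorem IsSeminormContractionSemigroup.commute (hS : IsSeminormContractionSemigroup Γ S)
    (t s : ℝ≥0) (x : X) : S t (S s x) = S s (S t x) := by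
  have h1 : S (t + s) x = S t (S s x) := by rw [hS.add]; rfl
  have h2 : S (s + t) x = S s (S t x) := by rw [hS.add]; rfl
  rw [← h1, ← h2, add_comm]

/-- The bounded operator `x ↦ x - (S h x - x) / h` is invertible. -/
theorem exists_resolvent_diffQuotient [CompleteSpace X] (hN : IsNorming Γ)
    (hS : IsSeminormContractionSemigroup Γ S) {h : ℝ≥0} (hh : 0 < h) :
    ∃ R : X →L[𝕜] X, (∀ x, R (x - diffQuotient S x h) = x) ∧
      ∀ x, R x - diffQuotient S (R x) h = x := by
  have hh' : (0 : ℝ) < h := hh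
  have hn : ‖S h‖ ≤ 1 := ContinuousLinearMap.opNorm_le_bound _ zero_le_one fun x =>
    hN.norm_le fun p hp => (hS.contract p hp h x).trans (by simpa using hN.le_norm hp x)
  -- Up to the scalar (1 + h)/h, the operator to invert is 1 − (1 + h)⁻¹S(h), which a Neumann series
  -- inverts.
  have hu : IsUnit (1 - (((1 + h : ℝ)⁻¹ : ℝ) : 𝕜) • S h) := by
    refine isUnit_one_sub_of_norm_lt_one ?_
    rw [norm_smul, RCLike.norm_of_nonneg (by positivity)]
    calc (1 + h : ℝ)⁻¹ * ‖S h‖ ≤ (1 + h : ℝ)⁻¹ * 1 := by gcongr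
      _ < 1 := by rw [mul_one]; exact inv_lt_one_of_one_lt₀ (by linarith)
  obtain ⟨U, hU⟩ := hu
  have hc : (((h : ℝ) : 𝕜)) ≠ 0 := by simpa using hh.ne'
  have hc' : (1 + ((h : ℝ) : 𝕜)) ≠ 0 := by
    have : ((1 + h : ℝ) : 𝕜) ≠ 0 := by
      rw [Ne, RCLike.ofReal_eq_zero]; positivity
    simpa using this
  have e : ∀ x, x - diffQuotient S x h
      = ((1 + ((h : ℝ) : 𝕜)) / ((h : ℝ) : 𝕜)) • (U : X →L[𝕜] X) x := fun x => by
    rw [hU, diffQuotient]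
    simp only [_root_.sub_apply, one_apply_eq_self,
      _root_.smul_apply]
    push_cast
    match_scalars <;> (field_simp; try ring)
  have h1 : ∀ x, (↑U⁻¹ : X →L[𝕜] X) ((U : X →L[𝕜] X) x) = x := fun x => by
    rw [← mul_apply_eq_comp, U.inv_mul]; rfl
  have h2 : ∀ x, (U : X →L[𝕜] X) ((↑U⁻¹ : X →L[𝕜] X) x) = x := fun x => by
    rw [← mul_apply_eq_comp, U.mul_inv]; rfl
  refine ⟨(((h : ℝ) : 𝕜) / (1 + ((h : ℝ) : 𝕜))) • (↑U⁻¹ : X →L[𝕜] X), fun x => ?_, fun x => ?_⟩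
  · rw [e]
    simp only [_root_.smul_apply, map_smul, h1, smul_smul]
    rw [div_mul_div_cancel₀ hc, div_self hc', one_smul]
  · rw [e]
    simp only [_root_.smul_apply, map_smul, h2, smul_smul]
    rw [div_mul_div_cancel₀ hc, div_self hc', one_smul]

/-- The resolvents at `1` of the difference quotients of a contraction semigroup converge to an
operator that inverts `1 - A` on the domain of the generator. -/
theorem exists_limit_resolvent {A : X →ₗ.[𝕜] X} (hτ : IsBiAdmissible 𝕜 τ)
    (hΓ : IsFundamentalSystem τ Γ) (hN : IsNorming Γ) (hdense : IsBiDenselyDefined τ A)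
    (hS : IsSeminormContractionSemigroup Γ S)
    (hA : ∀ x : A.domain, SeminormTendsto Γ (diffQuotient S (x : X)) (𝓝[>] 0) (A x)) :
    ∃ K : X →L[𝕜] X, (∀ p ∈ Γ, ∀ x, p (K x) ≤ p x) ∧ (∀ t x, K (S t x) = S t (K x)) ∧
      ∀ x : A.domain, K ((x : X) - A x) = x := by
  have := hτ.complete
  set h : ℕ → ℝ≥0 := fun n => 1 / (n + 1) with hh
  have hpos : ∀ n, 0 < h n := fun n => by simp only [hh]; positivity
  have hlim : Tendsto h atTop (𝓝[>] 0) := tendsto_div_nat_nhdsGT zero_lt_one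
  have hq : ∀ x : A.domain, SeminormTendsto Γ (fun n => diffQuotient S (x : X) (h n)) atTop (A x) :=
    fun x p hp => (hA x p hp).comp hlim
  choose R hR1 hR2 using fun n => exists_resolvent_diffQuotient hN hS (hpos n)
  have hdis : ∀ p ∈ Γ, ∀ n x, p x ≤ p (x - diffQuotient S x (h n)) := fun p hp n x => by
    simpa using mul_le_sub_diffQuotient hS hp zero_le_one (hpos n) x
  have hRp : ∀ p ∈ Γ, ∀ n x, p (R n x) ≤ p x := fun p hp n x => by
    simpa [hR2] using hdis p hp n (R n x)
  have hcomm : ∀ n t x, R n (S t x) = S t (R n x) := fun n t x => by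
    have e : S t x = S t (R n x) - diffQuotient S (S t (R n x)) (h n) := by
      rw [← map_diffQuotient (hS.commute t (h n)), ← map_sub, hR2]
    rw [e, hR1]
  have hdiff : ∀ p ∈ Γ, ∀ m n x, p (R m x - R n x)
      ≤ p (diffQuotient S x (h m) - diffQuotient S x (h n)) := fun p hp m n x => by
    refine (hdis p hp m _).trans ?_
    -- Second resolvent identity; with dissipativity it makes R n x Cauchy wherever the difference
    -- quotients are.
    have e : R m x - R n x - diffQuotient S (R m x - R n x) (h m)
        = R n (diffQuotient S x (h m) - diffQuotient S x (h n)) := by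
      rw [diffQuotient_sub, map_sub, map_diffQuotient (hcomm n _), map_diffQuotient (hcomm n _)]
      have h1 := hR2 m x
      have h2 := hR2 n x
      rw [← sub_eq_zero] at h1 h2 ⊢
      rw [← sub_eq_zero.2 (h1.trans h2.symm)]
      abel
    rw [e]
    exact hRp p hp n _
  obtain ⟨K, hK, hKp⟩ := exists_limit_operator hN hRp <|
    exists_seminormTendsto_of_biDense hτ hΓ hN hdense hRp fun x p hp ε hε => by
      filter_upwards [(hq x).eventually_sub_le hp hε] with n hn m hm
      exact (hdiff p hp m n x).trans (hn m hm)
  refine ⟨K, hKp, fun t x => ?_, fun x => ?_⟩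
  · refine SeminormTendsto.unique hN (hK (S t x)) ?_
    simp only [hcomm]
    exact (hK x).apply fun p hp => hS.contract p hp t
  · refine SeminormTendsto.unique hN
      ((hK _).apply_of_contract hRp ((SeminormTendsto.const (x : X)).sub (hq x))) ?_
    simp only [hR1]
    exact SeminormTendsto.const _

end Dissipative

/-! ### Generators of contraction semigroups and the range of 1 − A -/

section Generator

variable {T : ℝ≥0 → X →L[𝕜] X} {A : X →ₗ.[𝕜] X}

theorem IsGenerator.seminormTendsto (hA : IsGenerator τ T A) (hτ : IsBiAdmissible 𝕜 τ)
    (hΓ : IsFundamentalSystem τ Γ) (x : A.domain) :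
    SeminormTendsto Γ (diffQuotient T (x : X)) (𝓝[>] 0) (A x) :=
  (tendsto_iff_seminormTendsto hτ hΓ).1 (hA.2 x)

/-- For contraction semigroups the boundedness clause in the domain of the generator is automatic
once the quotients converge. -/
theorem norm_sub_div_le (hN : IsNorming Γ)
    (hT : IsSeminormContractionSemigroup Γ T) {x y : X}
    (h : SeminormTendsto Γ (diffQuotient T x) (𝓝[>] 0) y) {t : ℝ≥0} (ht : 0 < t) :
    ‖T t x - x‖ / t ≤ ‖y‖ := by
  rw [div_le_iff₀ (by exact_mod_cast ht), mul_comm]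
  exact hN.norm_le fun p hp => (hT.sub_self_le h hp t).trans
    (mul_le_mul_of_nonneg_left (hN.le_norm hp y) t.coe_nonneg)

theorem IsGenerator.exists_of_seminormTendsto (hA : IsGenerator τ T A) (hτ : IsBiAdmissible 𝕜 τ)
    (hΓ : IsFundamentalSystem τ Γ) (hN : IsNorming Γ)
    (hT : IsSeminormContractionSemigroup Γ T) {x y : X}
    (h : SeminormTendsto Γ (diffQuotient T x) (𝓝[>] 0) y) :
    ∃ z : A.domain, (z : X) = x ∧ A z = y := by
  have hx : x ∈ A.domain := (hA.1 x).2
    ⟨⟨y, (tendsto_iff_seminormTendsto hτ hΓ).2 h⟩, ‖y‖, fun t ht _ => norm_sub_div_le hN hT h ht⟩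
  exact ⟨⟨x, hx⟩, rfl, SeminormTendsto.unique hN (hA.seminormTendsto hτ hΓ ⟨x, hx⟩) h⟩

theorem IsBiContinuousSemigroup.exists_pos_forall_le (hT : IsBiContinuousSemigroup τ T)
    (hτ : IsBiAdmissible 𝕜 τ) (hΓ : IsFundamentalSystem τ Γ) (x : X) {p : Seminorm 𝕜 X}
    (hp : p ∈ Γ) {ε : ℝ} (hε : 0 < ε) : ∃ δ : ℝ≥0, 0 < δ ∧ ∀ s ≤ δ, p (T s x - x) ≤ ε := by
  have h : Tendsto (fun t => T t x) (𝓝 0) (@nhds X τ.top (T 0 x)) :=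
    @Continuous.tendsto _ _ _ τ.top _ (hT.stronglyContinuous x) 0
  have h1 := ((tendsto_iff_seminormTendsto hτ hΓ).1 h p hp).eventually_le_const hε
  rw [hT.zero] at h1
  obtain ⟨δ, hδ, hs⟩ := Metric.eventually_nhds_iff.1 h1
  lift δ to ℝ≥0 using hδ.le
  refine ⟨δ / 2, half_pos (by exact_mod_cast hδ), fun s hs' => hs ?_⟩
  rw [NNReal.dist_eq]
  have : (s : ℝ) ≤ δ / 2 := by exact_mod_cast hs'
  simp only [NNReal.coe_zero, sub_zero, NNReal.abs_eq]
  linarith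

/-- The range of `1 - A` is everything when `A` generates a contraction semigroup. -/
theorem IsGenerator.surjective_shift_one (hA : IsGenerator τ T A) (hτ : IsBiAdmissible 𝕜 τ)
    (hΓ : IsFundamentalSystem τ Γ) (hN : IsNorming Γ) (hdense : IsBiDenselyDefined τ A)
    (hTc : IsBiContinuousSemigroup τ T) (hT : IsSeminormContractionSemigroup Γ T) :
    Function.Surjective (shift A 1) := by
  intro x
  obtain ⟨K, hKp, hKT, hK⟩ :=
    exists_limit_resolvent hτ hΓ hN hdense hT (hA.seminormTendsto hτ hΓ)
  obtain ⟨u, hu⟩ := hdense.exists_seq hτ hΓ x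
  -- K commutes with T, so K v has generator value K(A v), and K(v − A v) = v rewrites this as K v −
  -- v, which no longer involves A.
  have hq : ∀ v : A.domain, SeminormTendsto Γ (diffQuotient T (K v)) (𝓝[>] 0) (K v - v) := by
    intro v
    have h1 := (hA.seminormTendsto hτ hΓ v).apply hKp
    have h2 : ∀ h, K (diffQuotient T (v : X) h) = diffQuotient T (K v) h := fun h =>
      map_diffQuotient (hKT h) _
    simp only [h2] at h1
    have h3 : K (A v) = K v - v := by
      have := hK v
      rw [map_sub] at this
      nth_rewrite 2 [← this]
      abel
    rwa [h3] at h1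
  -- The constant sequence of semigroups T turns the limit lemma into closedness of the graph under
  -- `Γ`-convergence.
  obtain ⟨h, -⟩ := tendsto_diffQuotient_of_tendsto (fun _ : ℕ => hT) (fun n => hq (u n))
    (hu.apply hKp) ((hu.apply hKp).sub hu)
    (fun t => (hu.apply hKp).apply fun p hp => hT.contract p hp t) fun p hp ε hε => by
      obtain ⟨δ, hδ, hs⟩ := hTc.exists_pos_forall_le hτ hΓ (K x - x) hp hε
      exact ⟨δ, hδ, fun _ => hs⟩
  obtain ⟨z, hz, hAz⟩ := hA.exists_of_seminormTendsto hτ hΓ hN hT h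
  exact ⟨z, by simp [shift, hz, hAz]⟩

end Generator

variable {A : X →ₗ.[𝕜] X}

/-! ### Resolvents of a dissipative operator -/

section Resolvent

/-- `R` is a two-sided inverse of `l - A`. -/
structure IsResolventAt (A : X →ₗ.[𝕜] X) (l : ℝ) (R : X →L[𝕜] X) : Prop where
  exists_preimage : ∀ x, ∃ z : A.domain, (z : X) = R x ∧ shift A l z = x
  apply_shift : ∀ z : A.domain, R (shift A l z) = z

theorem exists_isResolventAt (hN : IsNorming Γ) {l : ℝ} (hl : 0 < l)
    (hdis : ∀ p ∈ Γ, ∀ x : A.domain, l * p (x : X) ≤ p (shift A l x))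
    (hs : Function.Surjective (shift A l)) : ∃ R, IsResolventAt A l R := by
  let L : A.domain →ₗ[𝕜] X := (l : 𝕜) • A.domain.subtype - A.toFun
  have hL : ∀ z, L z = shift A l z := fun z => rfl
  have hinj : Function.Injective L := by
    rw [injective_iff_map_eq_zero]
    intro z hz
    have : (z : X) = 0 := hN.eq_of_forall fun p hp => by
      have h := hdis p hp z
      rw [← hL, hz, map_zero] at h
      rw [sub_zero]
      exact nonpos_of_mul_nonpos_right h hl
    exact Subtype.ext this
  let e := LinearEquiv.ofBijective L ⟨hinj, hs⟩
  have he : ∀ x, shift A l (e.symm x) = x := fun x => e.apply_symm_apply x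
  refine ⟨LinearMap.mkContinuous (A.domain.subtype ∘ₗ e.symm.toLinearMap) l⁻¹ fun x => ?_,
    fun x => ⟨e.symm x, rfl, he x⟩, fun z => ?_⟩
  · refine hN.norm_le fun p hp => ?_
    rw [inv_mul_eq_div, le_div_iff₀ hl, mul_comm]
    have h := hdis p hp (e.symm x)
    rw [he] at h
    exact h.trans (hN.le_norm hp x)
  · exact congrArg Subtype.val (e.symm_apply_apply z)

variable {l m : ℝ} {R Q : X →L[𝕜] X}

theorem IsResolventAt.seminorm_smul_le (hR : IsResolventAt A l R) (hl : 0 < l)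
    {p : Seminorm 𝕜 X} (hdis : ∀ x : A.domain, l * p (x : X) ≤ p (shift A l x)) (x : X) :
    p ((l : 𝕜) • R x) ≤ p x := by
  obtain ⟨z, hz, hx⟩ := hR.exists_preimage x
  rw [seminorm_ofReal_smul p hl.le, ← hz]
  simpa [hx] using hdis z

theorem shift_eq_add (A : X →ₗ.[𝕜] X) (l m : ℝ) (z : A.domain) :
    shift A m z = shift A l z + ((m - l : ℝ) : 𝕜) • (z : X) := by
  simp only [shift]
  push_cast
  rw [sub_smul]
  abel

theorem IsResolventAt.sub_apply (hR : IsResolventAt A l R) (hQ : IsResolventAt A m Q) (x : X) :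
    R x - Q x = ((m - l : ℝ) : 𝕜) • R (Q x) := by
  obtain ⟨z, hz, hx⟩ := hQ.exists_preimage x
  rw [shift_eq_add A l m] at hx
  have h := congrArg R hx
  rw [map_add, hR.apply_shift, map_smul, hz] at h
  rw [← h]
  abel

/-- For l ≠ m, apply the resolvent identity in both orders and cancel m − l; for l = m the two
inverses are equal. -/
theorem IsResolventAt.commute (hR : IsResolventAt A l R) (hQ : IsResolventAt A m Q) :
    Commute R Q := by
  ext x
  change R (Q x) = Q (R x)
  rcases eq_or_ne l m with rfl | hne
  · have h : ∀ y, R y = Q y := fun y => by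
      have := hR.sub_apply hQ y
      simpa [sub_eq_zero] using this
    rw [h, h]
  · have h1 := hR.sub_apply hQ x
    have h2 := hQ.sub_apply hR x
    have hc : ((m - l : ℝ) : 𝕜) ≠ 0 := by
      rw [Ne, RCLike.ofReal_eq_zero]
      exact sub_ne_zero.2 hne.symm
    refine smul_right_injective X hc ?_
    change ((m - l : ℝ) : 𝕜) • R (Q x) = ((m - l : ℝ) : 𝕜) • Q (R x)
    rw [← h1, ← neg_sub l m, RCLike.ofReal_neg, neg_smul, ← h2]
    abel

/-- (3l/2 − A)R = 1 + ½(lR), and lR is a contraction, so a Neumann series applies. Any factor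
strictly between 1 and 2 would do. -/
theorem surjective_shift_mul [CompleteSpace X] (hN : IsNorming Γ) (hl : 0 < l)
    (hdis : ∀ p ∈ Γ, ∀ x : A.domain, l * p (x : X) ≤ p (shift A l x))
    (hs : Function.Surjective (shift A l)) : Function.Surjective (shift A (l * (3 / 2))) := by
  obtain ⟨R, hR⟩ := exists_isResolventAt hN hl hdis hs
  have hn : ‖(l : 𝕜) • R‖ ≤ 1 := ContinuousLinearMap.opNorm_le_bound _ zero_le_one fun x =>
    hN.norm_le fun p hp => (hR.seminorm_smul_le hl (hdis p hp) x).trans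
      (by simpa using hN.le_norm hp x)
  have hu : IsUnit (1 - (-((1 / 2 : ℝ) : 𝕜)) • ((l : 𝕜) • R)) := by
    refine isUnit_one_sub_of_norm_lt_one ?_
    rw [norm_smul, norm_neg, RCLike.norm_of_nonneg (by norm_num)]
    linarith
  obtain ⟨U, hU⟩ := hu
  intro x
  obtain ⟨z, hz, hy⟩ := hR.exists_preimage ((↑U⁻¹ : X →L[𝕜] X) x)
  refine ⟨z, ?_⟩
  have h : (U : X →L[𝕜] X) ((↑U⁻¹ : X →L[𝕜] X) x) = x := by
    rw [← mul_apply_eq_comp, U.mul_inv]; rfl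
  rw [shift_eq_add A l, hy, hz]
  conv_rhs => rw [← h, hU]
  simp only [_root_.sub_apply, one_apply_eq_self, _root_.smul_apply]
  push_cast
  module

theorem surjective_shift_mul_pow [CompleteSpace X] (hN : IsNorming Γ) (hl : 0 < l)
    (hdis : ∀ l : ℝ, 0 < l → ∀ p ∈ Γ, ∀ x : A.domain, l * p (x : X) ≤ p (shift A l x))
    (hs : Function.Surjective (shift A l)) (n : ℕ) :
    Function.Surjective (shift A (l * (3 / 2) ^ n)) := by
  induction n with
  | zero => simpa using hs
  | succ n ih =>
    rw [pow_succ, ← mul_assoc]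
    have h0 : 0 < l * (3 / 2) ^ n := by positivity
    exact surjective_shift_mul hN h0 (hdis _ h0) ih

end Resolvent

/-! ### Exponential semigroups of bounded operators -/

section Exponential

/-- The semigroup `t ↦ exp (t Y)` generated by a bounded operator `Y`. -/
noncomputable def expSemigroup (Y : X →L[𝕜] X) (t : ℝ≥0) : X →L[𝕜] X :=
  NormedSpace.exp (((t : ℝ) : 𝕜) • Y)

theorem commute_expSemigroup {Y Z : X →L[𝕜] X} (h : Commute Y Z) (t s : ℝ≥0) (x : X) :
    expSemigroup Y t (expSemigroup Z s x) = expSemigroup Z s (expSemigroup Y t x) := by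
  have := (((h.smul_left ((t : ℝ) : 𝕜)).smul_right ((s : ℝ) : 𝕜)).exp)
  exact congrArg (fun f : X →L[𝕜] X => f x) this.eq

variable [CompleteSpace X]

/-- The series converges in norm, p is norm-continuous because `Γ` is norming, and each power of N
is a p-contraction. -/
theorem seminorm_exp_smul_le (hN : IsNorming Γ) {p : Seminorm 𝕜 X} (hp : p ∈ Γ) {N : X →L[𝕜] X}
    (hNp : ∀ x, p (N x) ≤ p x) {r : ℝ} (hr : 0 ≤ r) (x : X) :
    p (NormedSpace.exp ((r : 𝕜) • N) x) ≤ Real.exp r * p x := by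
  have h1 := NormedSpace.exp_series_hasSum_exp' (𝕂 := 𝕜) ((r : 𝕜) • N)
  have h2 := (ContinuousLinearMap.apply 𝕜 X x).hasSum h1
  have h3 : HasSum (fun n : ℕ => r ^ n / n.factorial * p x) (Real.exp r * p x) := by
    rw [Real.exp_eq_exp_ℝ]
    exact (NormedSpace.expSeries_div_hasSum_exp r).mul_right _
  have hpow : ∀ n : ℕ, p ((N ^ n) x) ≤ p x := fun n => by
    induction n with
    | zero => simp
    | succ n ih =>
      rw [pow_succ', mul_apply_eq_comp]
      exact (hNp _).trans ih
  refine le_of_tendsto_of_tendsto' (((hN.continuous hp).tendsto _).comp h2) h3 fun s => ?_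
  refine (Finset.le_sum_of_subadditive p (map_zero p).le (map_add_le_add p) _ _).trans
    (Finset.sum_le_sum fun n _ => ?_)
  have e : ContinuousLinearMap.apply 𝕜 X x ((n.factorial : 𝕜)⁻¹ • ((r : 𝕜) • N) ^ n)
      = ((r ^ n / n.factorial : ℝ) : 𝕜) • (N ^ n) x := by
    rw [smul_pow, smul_smul]
    simp [div_eq_inv_mul]
  rw [e, seminorm_ofReal_smul p (by positivity)]
  gcongr
  exact hpow n

/-- exp(tc(N − 1)) = e^{−tc} exp(tcN), and the scalar cancels the growth e^{tc} of the second
factor. -/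
theorem isSeminormContractionSemigroup_expSemigroup (hN : IsNorming Γ) {N : X →L[𝕜] X}
    (hNp : ∀ p ∈ Γ, ∀ x, p (N x) ≤ p x) {c : ℝ} (hc : 0 ≤ c) :
    IsSeminormContractionSemigroup Γ (expSemigroup ((c : 𝕜) • (N - 1))) where
  zero := by simp [expSemigroup]; rfl
  add t s := by
    let : NormedAlgebra ℚ (X →L[𝕜] X) := NormedAlgebra.restrictScalars ℚ 𝕜 _
    have h : Commute (((t : ℝ) : 𝕜) • ((c : 𝕜) • (N - 1))) (((s : ℝ) : 𝕜) • ((c : 𝕜) • (N - 1))) :=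
      ((Commute.refl _).smul_left _).smul_right _
    have h1 := NormedSpace.exp_add_of_commute h
    rw [← add_smul, ← RCLike.ofReal_add, ← NNReal.coe_add] at h1
    exact h1
  contract p hp t x := by
    let : NormedAlgebra ℚ (X →L[𝕜] X) := NormedAlgebra.restrictScalars ℚ 𝕜 _
    have hr : (0 : ℝ) ≤ t * c := by positivity
    have e : ((t : ℝ) : 𝕜) • ((c : 𝕜) • (N - 1))
        = algebraMap 𝕜 (X →L[𝕜] X) ((-(t * c) : ℝ) : 𝕜) + ((t * c : ℝ) : 𝕜) • N := by
      rw [Algebra.algebraMap_eq_smul_one]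
      push_cast
      module
    have h := NormedSpace.exp_add_of_commute
      (Algebra.commutes ((-(t * c) : ℝ) : 𝕜) (((t * c : ℝ) : 𝕜) • N))
    rw [← e, ← NormedSpace.algebraMap_exp_comm, Algebra.algebraMap_eq_smul_one, smul_mul_assoc,
      one_mul] at h
    have h1 : NormedSpace.exp ((-(t * c) : ℝ) : 𝕜) = ((Real.exp (-(t * c)) : ℝ) : 𝕜) := by
      rw [Real.exp_eq_exp_ℝ]
      exact (NormedSpace.algebraMap_exp_comm (𝔸 := 𝕜) (-(t * c) : ℝ)).symm
    rw [expSemigroup, h, h1, _root_.smul_apply, seminorm_ofReal_smul p (Real.exp_pos _).le]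
    calc Real.exp (-(t * c)) * p (NormedSpace.exp (((t * c : ℝ) : 𝕜) • N) x)
        ≤ Real.exp (-(t * c)) * (Real.exp (t * c) * p x) := by
          gcongr
          exact seminorm_exp_smul_le hN hp (hNp p hp) hr x
      _ = p x := by rw [← mul_assoc, ← Real.exp_add]; simp

theorem seminormTendsto_diffQuotient_expSemigroup (hN : IsNorming Γ) (Y : X →L[𝕜] X) (x : X) :
    SeminormTendsto Γ (diffQuotient (expSemigroup Y) x) (𝓝[>] 0) (Y x) := by
  refine SeminormTendsto.of_tendsto hN ?_
  have h1 : HasDerivAt (fun u : 𝕜 => NormedSpace.exp (u • Y) x) (Y x) 0 := by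
    have h := hasDerivAt_exp_smul_const (𝕂 := 𝕜) Y 0
    rw [zero_smul, NormedSpace.exp_zero, one_mul] at h
    exact (ContinuousLinearMap.apply 𝕜 X x).hasFDerivAt.comp_hasDerivAt (0 : 𝕜) h
  have h2 := hasDerivAt_iff_tendsto_slope_zero.1 h1
  have h3 : Tendsto (fun t : ℝ≥0 => ((t : ℝ) : 𝕜)) (𝓝[>] 0) (𝓝[≠] 0) := by
    rw [tendsto_nhdsWithin_iff]
    constructor
    · have : Continuous fun t : ℝ≥0 => ((t : ℝ) : 𝕜) := by fun_prop
      simpa using (this.tendsto 0).mono_left nhdsWithin_le_nhds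
    · filter_upwards [self_mem_nhdsWithin] with t ht
      simpa using ht.ne'
  refine (h2.comp h3).congr fun t => ?_
  simp [diffQuotient, expSemigroup]

end Exponential

/-! ### Yosida approximation and the generated semigroup -/

section Generation

/-- Hille–Yosida type generation: a bi-dissipative operator with a surjective shift has a
`Γ`-contractive semigroup whose generator extends it. -/
theorem exists_contractionSemigroup (hτ : IsBiAdmissible 𝕜 τ) (hΓ : IsFundamentalSystem τ Γ)
    (hN : IsNorming Γ) (hdense : IsBiDenselyDefined τ A)
    (hdis : ∀ l : ℝ, 0 < l → ∀ p ∈ Γ, ∀ x : A.domain, l * p (x : X) ≤ p (shift A l x))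
    {l : ℝ} (hl : 0 < l) (hs : Function.Surjective (shift A l)) :
    ∃ T : ℝ≥0 → X →L[𝕜] X, IsSeminormContractionSemigroup Γ T ∧
      (∀ x, ∀ p ∈ Γ, ∀ ε : ℝ, 0 < ε → ∃ δ : ℝ≥0, 0 < δ ∧ ∀ s ≤ δ, p (T s x - x) ≤ ε) ∧
      ∀ x : A.domain, SeminormTendsto Γ (diffQuotient T (x : X)) (𝓝[>] 0) (A x) := by
  have := hτ.complete
  set r : ℕ → ℝ := fun n => l * (3 / 2) ^ n with hr
  have hr0 : ∀ n, 0 < r n := fun n => by simp only [hr]; positivity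
  have hrlim : Tendsto r atTop atTop :=
    (tendsto_pow_atTop_atTop_of_one_lt (by norm_num)).const_mul_atTop hl
  choose R hR using fun n => exists_isResolventAt hN (hr0 n) (hdis _ (hr0 n))
    (surjective_shift_mul_pow hN hl hdis hs n)
  set N : ℕ → X →L[𝕜] X := fun n => (r n : 𝕜) • R n with hNdef
  have hNp : ∀ p ∈ Γ, ∀ n x, p (N n x) ≤ p x := fun p hp n x =>
    (hR n).seminorm_smul_le (hr0 n) (hdis _ (hr0 n) p hp) x
  have hRA : ∀ n (x : A.domain), N n (x : X) - x = R n (A x) := fun n x => by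
    have h := (hR n).apply_shift x
    simp only [shift, map_sub, map_smul] at h
    simp only [hNdef, _root_.smul_apply]
    nth_rewrite 2 [← h]
    abel
  have hNid : ∀ x, SeminormTendsto Γ (fun n => N n x) atTop x := by
    refine seminormTendsto_self_of_biDense hτ hΓ hdense hNp fun x p hp => ?_
    have lim : Tendsto (fun n => (r n)⁻¹ * p (A x)) atTop (𝓝 0) := by
      simpa using (tendsto_inv_atTop_zero.comp hrlim).mul_const (p (A x))
    refine squeeze_zero (fun n => apply_nonneg p _) (fun n => ?_) lim
    have h := hNp p hp n (A x)
    rw [hNdef, _root_.smul_apply, seminorm_ofReal_smul p (hr0 n).le] at h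
    rw [hRA, inv_mul_eq_div, le_div_iff₀ (hr0 n), mul_comm]
    exact h
  -- Yosida approximation: on D(A) it equals N n ∘ A, hence tends to A there and satisfies p(Y n x)
  -- ≤ p(A x).
  set Y : ℕ → X →L[𝕜] X := fun n => (r n : 𝕜) • (N n - 1) with hY
  have hYA : ∀ n (x : A.domain), Y n x = N n (A x) := fun n x => by
    have h := hRA n x
    simp only [hY, _root_.smul_apply, _root_.sub_apply, one_apply_eq_self, h]
    rfl
  have hYlim : ∀ x : A.domain, SeminormTendsto Γ (fun n => Y n x) atTop (A x) := fun x => by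
    simp only [hYA]
    exact hNid (A x)
  set S : ℕ → ℝ≥0 → X →L[𝕜] X := fun n => expSemigroup (Y n) with hSdef
  have hS : ∀ n, IsSeminormContractionSemigroup Γ (S n) := fun n =>
    isSeminormContractionSemigroup_expSemigroup hN (fun p hp => hNp p hp n) (hr0 n).le
  have hSY : ∀ n x, SeminormTendsto Γ (diffQuotient (S n) x) (𝓝[>] 0) (Y n x) := fun n x =>
    seminormTendsto_diffQuotient_expSemigroup hN (Y n) x
  have hcomm : ∀ m n, Commute (Y m) (Y n) := fun m n => by
    have h : Commute (N m) (N n) := (((hR m).commute (hR n)).smul_left _).smul_right _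
    exact (((h.sub_left (Commute.one_left _)).sub_right
      ((Commute.one_right _).sub_left (Commute.one_right _))).smul_left _).smul_right _
  have hlim : ∀ t x, ∃ y, SeminormTendsto Γ (fun n => S n t x) atTop y := fun t =>
    exists_seminormTendsto_of_biDense hτ hΓ hN hdense (fun p hp n x => (hS n).contract p hp t x)
      fun x p hp ε hε => by
        have hε' : 0 < ε / ((t : ℝ) + 1) := by positivity
        filter_upwards [(hYlim x).eventually_sub_le hp hε'] with n hn m hm
        refine ((hS m).sub_le (hS n) (commute_expSemigroup (hcomm m n)) (hSY m x) (hSY n x)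
          hp t).trans ?_
        calc (t : ℝ) * p (Y m x - Y n x) ≤ (t + 1) * (ε / ((t : ℝ) + 1)) := by
              gcongr
              · linarith
              · exact hn m hm
          _ = ε := by field_simp
  choose T hT hTp using fun t => exists_limit_operator hN
    (fun p hp n x => (hS n).contract p hp t x) (hlim t)
  -- Continuity at 0 uniform in n: on D(A) the bound p(Y n v) ≤ p(A v) does not depend on n, and
  -- contractivity handles the rest. The + 1 below avoids a zero denominator.
  have hsmall : ∀ x, ∀ p ∈ Γ, ∀ ε : ℝ, 0 < ε →
      ∃ δ : ℝ≥0, 0 < δ ∧ ∀ n, ∀ s ≤ δ, p (S n s x - x) ≤ ε := fun x p hp ε hε => by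
    obtain ⟨v, hv⟩ := hdense.exists_near hτ hΓ x hp (ε := ε / 3) (by positivity)
    have hδ : 0 < ε / 3 / (p (A v) + 1) := by positivity
    refine ⟨⟨_, hδ.le⟩, hδ, fun n s hs => ?_⟩
    have hs' : (s : ℝ) ≤ ε / 3 / (p (A v) + 1) := hs
    have h1 : p (S n s v - v) ≤ ε / 3 := by
      refine ((hS n).sub_self_le (hSY n v) hp s).trans ?_
      calc (s : ℝ) * p (Y n v) ≤ ε / 3 / (p (A v) + 1) * (p (A v) + 1) := by
            gcongr
            rw [hYA]
            linarith [hNp p hp n (A v)]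
        _ = ε / 3 := by field_simp
    have h2 := (hS n).contract p hp s (x - v)
    rw [map_sub, map_sub_rev p x] at h2
    linarith [seminorm_sub_le p (S n s x) (S n s v) x, seminorm_sub_le p (S n s v) v x]
  refine ⟨T, ⟨?_, fun t s => ?_, fun p hp t => hTp t p hp⟩, fun x p hp ε hε => ?_, fun x => ?_⟩
  · ext x
    refine SeminormTendsto.unique hN (hT 0 x) ?_
    simp only [(hS _).zero]
    exact SeminormTendsto.const _
  · ext x
    refine SeminormTendsto.unique hN (hT (t + s) x) ?_
    simp only [(hS _).add]
    exact (hT t (T s x)).apply_of_contract (fun p hp n => (hS n).contract p hp t) (hT s x)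
  · obtain ⟨δ, hδ, h⟩ := hsmall x p hp ε hε
    exact ⟨δ, hδ, fun s hs => le_of_tendsto'
      (((hT s x).sub (SeminormTendsto.const x)).tendsto hp) fun n => h n s hs⟩
  · exact (tendsto_diffQuotient_of_tendsto hS (fun n => hSY n x) (SeminormTendsto.const _)
      (hYlim x) (fun t => hT t x) (hsmall (A x))).1

variable {T : ℝ≥0 → X →L[𝕜] X}

theorem IsSeminormContractionSemigroup.isContractive (hT : IsSeminormContractionSemigroup Γ T)
    (hN : IsNorming Γ) : IsContractive T := fun t =>
  ContinuousLinearMap.opNorm_le_bound _ zero_le_one fun x =>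
    hN.norm_le fun p hp => (hT.contract p hp t x).trans (by simpa using hN.le_norm hp x)

theorem IsSeminormContractionSemigroup.isBiContinuousSemigroup
    (hT : IsSeminormContractionSemigroup Γ T) (hτ : IsBiAdmissible 𝕜 τ)
    (hΓ : IsFundamentalSystem τ Γ) (hN : IsNorming Γ)
    (hcont : ∀ x, ∀ p ∈ Γ, ∀ ε : ℝ, 0 < ε → ∃ δ : ℝ≥0, 0 < δ ∧ ∀ s ≤ δ, p (T s x - x) ≤ ε) :
    IsBiContinuousSemigroup τ T where
  zero := hT.zero
  add := hT.add
  stronglyContinuous x := by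
    refine (@continuous_iff_continuousAt _ _ _ τ.top _).2 fun t₀ => ?_
    refine (tendsto_iff_seminormTendsto hτ hΓ).2 fun p hp => ?_
    rw [Metric.tendsto_nhds]
    intro ε hε
    obtain ⟨δ, hδ, h⟩ := hcont x p hp (ε / 2) (half_pos hε)
    -- The later time is the earlier one plus r, so contractivity reduces continuity at any time to
    -- continuity at 0, from both sides.
    have key : ∀ s t : ℝ≥0, s ≤ t → dist t s < δ → p (T t x - T s x) ≤ ε / 2 := by
      intro s t hst hd
      obtain ⟨r, rfl⟩ := exists_add_of_le hst
      rw [NNReal.dist_eq, NNReal.coe_add, add_sub_cancel_left, NNReal.abs_eq] at hd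
      have e : T (s + r) x - T s x = T s (T r x - x) := by rw [hT.add, map_sub]; rfl
      rw [e]
      exact (hT.contract p hp s _).trans (h r (by exact_mod_cast hd.le))
    filter_upwards [Metric.ball_mem_nhds t₀ (show (0 : ℝ) < δ from hδ)] with t ht
    rw [Real.dist_0_eq_abs, abs_of_nonneg (apply_nonneg p _)]
    refine lt_of_le_of_lt ?_ (half_lt_self hε)
    rcases le_total t₀ t with h' | h'
    · exact key t₀ t h' ht
    · rw [map_sub_rev]
      exact key t t₀ h' (by rw [dist_comm]; exact ht)
  expBounded := ⟨1, 0, le_rfl, fun t => by simpa using hT.isContractive hN t⟩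
  locallyBiEquicontinuous u _ hu t₀ U hU := by
    obtain ⟨p, hp, ε, hε, hsub⟩ := hΓ.2 U hU
    have h := ((tendsto_iff_seminormTendsto hτ hΓ).1 hu p hp).eventually_lt_const hε
    filter_upwards [h] with n hn s _
    rw [sub_zero] at hn
    exact hsub ((hT.contract p hp s _).trans_lt hn)

/-- If the generator of `T` extends `A` and `l - A` is onto, then `A` is the generator. -/
theorem isGenerator_of_surjective_shift (hτ : IsBiAdmissible 𝕜 τ) (hΓ : IsFundamentalSystem τ Γ)
    (hN : IsNorming Γ) (hT : IsSeminormContractionSemigroup Γ T)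
    (hA : ∀ x : A.domain, SeminormTendsto Γ (diffQuotient T (x : X)) (𝓝[>] 0) (A x))
    {l : ℝ} (hl : 0 < l) (hs : Function.Surjective (shift A l)) : IsGenerator τ T A := by
  refine ⟨fun x => ⟨fun hx => ⟨⟨A ⟨x, hx⟩, (tendsto_iff_seminormTendsto hτ hΓ).2 (hA ⟨x, hx⟩)⟩,
    ‖A ⟨x, hx⟩‖, fun t ht _ => norm_sub_div_le hN hT (hA ⟨x, hx⟩) ht⟩, ?_⟩,
    fun x => (tendsto_iff_seminormTendsto hτ hΓ).2 (hA x)⟩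
  rintro ⟨⟨y, hy⟩, -⟩
  rw [tendsto_iff_seminormTendsto hτ hΓ] at hy
  -- This z makes z − x an element of the kernel of l minus the generator, which dissipativity shows
  -- to be trivial.
  obtain ⟨z, hz⟩ := hs ((l : 𝕜) • x - y)
  have hd : SeminormTendsto Γ (diffQuotient T ((z : X) - x)) (𝓝[>] 0) (A z - y) := by
    have := (hA z).sub hy
    simpa only [← diffQuotient_sub] using this
  have hzx : (z : X) = x := hN.eq_of_forall fun p hp => by
    have h := mul_le_sub_of_tendsto hT hp hl.le hd
    have e : (l : 𝕜) • ((z : X) - x) - (A z - y) = 0 := by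
      rw [← sub_eq_zero] at hz
      rw [← hz, shift, smul_sub]
      abel
    rw [e, map_zero] at h
    exact nonpos_of_mul_nonpos_right h hl
  exact hzx ▸ z.2

end Generation

end BiContinuous

/-! ### The equivalence -/

open BiContinuous in
theorem proposition3p10 {𝕜 X : Type*} [RCLike 𝕜] [NormedAddCommGroup X] [NormedSpace 𝕜 X]
    (τ : SecondTopology X) (hτ : IsBiAdmissible 𝕜 τ)
    (A : X →ₗ.[𝕜] X) (hdense : IsBiDenselyDefined τ A) (hclosed : A.IsClosed) :
    (∃ T : ℝ≥0 → X →L[𝕜] X,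
      IsBiContinuousSemigroup τ T ∧ IsContractive T ∧ IsGenerator τ T A ∧
      ∃ Γ : Set (Seminorm 𝕜 X), IsFundamentalSystem τ Γ ∧ IsNorming Γ ∧
        ∀ t : ℝ≥0, ∀ p ∈ Γ, ∀ x : X, p (T t x) ≤ p x) ↔
    (IsBiDissipative τ A ∧ ∃ l : ℝ, 0 < l ∧ Function.Surjective (shift A l)) := by
  constructor
  · rintro ⟨T, hTc, -, hA, Γ, hΓ, hN, hp⟩
    have hT : IsSeminormContractionSemigroup Γ T := ⟨hTc.zero, hTc.add, fun p hpΓ t => hp t p hpΓ⟩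
    exact ⟨⟨Γ, hΓ, fun l hl p hpΓ x => mul_le_sub_of_tendsto hT hpΓ hl.le
      (hA.seminormTendsto hτ hΓ x), hN⟩, 1, one_pos,
      hA.surjective_shift_one hτ hΓ hN hdense hTc hT⟩
  · rintro ⟨⟨Γ, hΓ, hdis, hN⟩, l, hl, hs⟩
    obtain ⟨T, hT, hcont, hA⟩ := exists_contractionSemigroup hτ hΓ hN hdense hdis hl hs
    exact ⟨T, hT.isBiContinuousSemigroup hτ hΓ hN hcont, hT.isContractive hN,
      isGenerator_of_surjective_shift hτ hΓ hN hT hA hl hs, Γ, hΓ, hN,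
      fun t p hp => hT.contract p hp t⟩
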